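/- Let $E$ be a finite-dimensional real vector space with dual $E^*$, $U\subseteq E$ a linear subspace, $f:E\times U\to E$ and $L:E\times U\to\mathbb R$ smooth ($C^\infty$), $0=t_0<t_1<\dots<t_N=T$ a partition of $[0,T]$ ($T>0$), $G_1,\dots,G_N:E\to\mathbb R$ differentiable, $\epsilon>0$ and $x_0\in E$. Call a curve smooth with limits on $]a,b[$ if it is $C^\infty$ on $]a,b[$ and has finite one-sided limits at $a^+$ and $b^-$. For $j=1,\dots,N$ and $x_{j-1}\in E$, an admissible pair for the problem $P_j$ consists of $x:[t_{j-1},t_j]\to E$, continuous on $[t_{j-1},t_j]$, and $u$ with values in $U$, both smooth with limits on $]t_{j-1},t_j[$, such that $x(t_{j-1})=x_{j-1}$ and $\dot x=f(x,u)$ on $]t_{j-1},t_j[$; the end point $x(t_j)$ is free. The problem $P_j$ (a Bolza problem) is to minimize $$J_j=\int_{t_{j-1}}^{t_j}L(x(t),u(t))\,dt+\frac1\epsilon G_j(x(t_j))$$ over all admissible pairs. Let $x:[0,T]\to E$ be continuous with $x(0)=x_0$ and let $u:[0,T]\to U$ be such that, for every $j=1,\dots,N$, the restriction of $(x,u)$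 to $[t_{j-1},t_j]$ is an optimal solution (a global minimizer) of $P_j$ with initial state $x_{j-1}=x(t_{j-1})$, the final state of the previous subinterval. Put $h(x,p,u)=p(f(x,u))-L(x,u)$ for $x\in E$, $p\in E^*$, $u\in U$. Then there is a costate trajectory $p:[0,T]\to E^*$, smooth with limits on each $]t_{j-1},t_j[$, such that for every $j=1,\dots,N$, on $]t_{j-1},t_j[$, $$\dot x=\frac{\delta h}{\delta p}(x,p,u),\qquad \dot p=-\frac{\delta h}{\delta x}(x,p,u),\qquad \frac{\delta h}{\delta u}(x,p,u)=0,$$ where the partial derivatives are elements of $E$ (identified with $E^{**}$), $E^*$ and $U^*$ respectively, and $$p(t_j^-)=-\frac1\epsilon\,\frac{\delta G_j}{\delta x}(x(t_j)).$$ -/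

import Mathlib

open Set Filter Topology
open scoped ContDiff

noncomputable section

namespace BolzaChain

variable {E : Type*} [NormedAddCommGroup E] [NormedSpace ℝ E]

/-- A curve which is `C^∞` on the open interval `]a, b[` and has finite one-sided limits
`y(a⁺)` and `y(b⁻)` (the value of `y` at `a` and `b` plays no role). -/
structure SmoothWithLimits {F : Type*} [NormedAddCommGroup F] [NormedSpace ℝ F]
    (a b : ℝ) (y : ℝ → F) : Prop where
  smooth : ContDiffOn ℝ ∞ y (Ioo a b)
  limit_left_end : ∃ l : F, Tendsto y (𝓝[>] a) (𝓝 l)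
  limit_right_end : ∃ l : F, Tendsto y (𝓝[<] b) (𝓝 l)

/-- A curve which is piecewise smooth with respect to the partition `t 0 < ⋯ < t N`. -/
def PiecewiseSmooth {F : Type*} [NormedAddCommGroup F] [NormedSpace ℝ F]
    {N : ℕ} (t : Fin (N + 1) → ℝ) (y : ℝ → F) : Prop :=
  ∀ j : Fin N, SmoothWithLimits (t j.castSucc) (t j.succ) y

/-- `(x, u)` is an admissible pair (state trajectory, control) on `[a, b]` for the control system
`ẋ = f(x, u)` with initial state `xa`; the final state is free. -/
structure IsAdmissible {U : Submodule ℝ E} (f : E × U → E) (a b : ℝ) (xa : E)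
    (x : ℝ → E) (u : ℝ → U) : Prop where
  continuousOn_state : ContinuousOn x (Icc a b)
  smooth_state : SmoothWithLimits a b x
  smooth_control : SmoothWithLimits a b u
  initial : x a = xa
  dynamics : ∀ s ∈ Ioo a b, HasDerivAt x (f (x s, u s)) s

/-- The Bolza functional `∫ₐᵇ L(x, u) dt + (1/ε) G(x(b))`. -/
def bolzaCost {U : Submodule ℝ E} (L : E × U → ℝ) (G : E → ℝ) (ε a b : ℝ)
    (x : ℝ → E) (u : ℝ → U) : ℝ :=
  (∫ s in a..b, L (x s, u s)) + (1 / ε) * G (x b)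

/-- `u` is an optimal control, with optimal trajectory `x`, of the Bolza problem on `[a, b]` with
initial state `xa` and free final state. -/
def IsBolzaOptimal {U : Submodule ℝ E} (f : E × U → E) (L : E × U → ℝ) (G : E → ℝ) (ε a b : ℝ)
    (xa : E) (x : ℝ → E) (u : ℝ → U) : Prop :=
  IsAdmissible f a b xa x u ∧
    ∀ (y : ℝ → E) (v : ℝ → U), IsAdmissible f a b xa y v →
      bolzaCost L G ε a b x u ≤ bolzaCost L G ε a b y v

/-- `u` is the optimal control, with optimal trajectory `x`, of the chain of Bolza problems on the
intervals `[t j, t (j + 1)]`: the first problem starts at `x₀`, and each other one at the final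
state reached by the optimal trajectory of the previous one. -/
structure IsChainOptimal {U : Submodule ℝ E} (f : E × U → E) (L : E × U → ℝ) {N : ℕ}
    (G : Fin N → E → ℝ) (ε : ℝ) (t : Fin (N + 1) → ℝ) (x₀ : E)
    (x : ℝ → E) (u : ℝ → U) : Prop where
  initial : x (t 0) = x₀
  continuousOn_state : ContinuousOn x (Icc (t 0) (t (Fin.last N)))
  optimal : ∀ j : Fin N,
    IsBolzaOptimal f L (G j) ε (t j.castSucc) (t j.succ) (x (t j.castSucc)) x u

/-- The Hamiltonian function `h(x, p, u) = p(f(x, u)) - L(x, u)`. -/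
def hamiltonian {U : Submodule ℝ E} (f : E × U → E) (L : E × U → ℝ)
    (x : E) (p : StrongDual ℝ E) (u : U) : ℝ :=
  p (f (x, u)) - L (x, u)

/-- The partial derivative `δh/δx`, an element of `E*`. -/
def partialX {U : Submodule ℝ E} (h : E → StrongDual ℝ E → U → ℝ)
    (x : E) (p : StrongDual ℝ E) (u : U) : StrongDual ℝ E :=
  fderiv ℝ (fun y => h y p u) x

/-- The partial derivative `δh/δp`, an element of `E` through the canonical isomorphism
`E ≃ E**` of the finite-dimensional space `E`. -/
def partialP [FiniteDimensional ℝ E] {U : Submodule ℝ E} (h : E → StrongDual ℝ E → U → ℝ)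
    (x : E) (p : StrongDual ℝ E) (u : U) : E :=
  (Module.evalEquiv ℝ E).symm
    ((fderiv ℝ (fun q => h x q u) p).toLinearMap ∘ₗ
      (LinearMap.toContinuousLinearMap : (E →ₗ[ℝ] ℝ) ≃ₗ[ℝ] (E →L[ℝ] ℝ)).toLinearMap)

/-- The partial derivative `δh/δu`, an element of `U*`. -/
def partialU {U : Submodule ℝ E} (h : E → StrongDual ℝ E → U → ℝ)
    (x : E) (p : StrongDual ℝ E) (u : U) : StrongDual ℝ U :=
  fderiv ℝ (fun v => h x p v) u

end BolzaChain

end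

/-! On each subinterval, solve the costate equation backward from the prescribed terminal value; it
is affine in `p`, so the solution exists on the whole interval. Pairing `p` with the difference of
two admissible trajectories and integrating its derivative gives an exact identity
(`bolzaCost_sub_eq`): the cost increment plus the integral of `δh/δu` applied to the change of
control equals the first-order Taylor remainder of `G / ε` minus the integral of that of `h`. No
linearized state equation is needed. For controls `u + l • w` the trajectory moves by `O(l)`
(`exists_admissible_variation`, by cut-off and Grönwall), so the right-hand side is `o(l)`.
Optimality with both signs of `l` kills the integral of `δh/δu` against `w`
(`integral_partialU_eq_zero`), and the fundamental lemma of the calculus of variations gives `δh/δu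
= 0`. The costates are then glued; nothing has to match at the nodes. -/

namespace BolzaChain

open MeasureTheory

/-! ### Cut-offs, Taylor remainders, global existence and Grönwall estimates -/

section Analysis

lemma lipschitzWith_left_of_prod {X Y Z : Type*} [PseudoEMetricSpace X] [PseudoEMetricSpace Y]
    [PseudoEMetricSpace Z] {Ψ : X × Y → Z} {K : NNReal} (hK : LipschitzWith K Ψ) (c : Y) :
    LipschitzWith K (fun y => Ψ (y, c)) := by
  simpa [Function.comp_def] using hK.comp (LipschitzWith.prodMk_right (α := X) c)

variable {V : Type*} [NormedAddCommGroup V] [NormedSpace ℝ V]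
  {W : Type*} [NormedAddCommGroup W] [NormedSpace ℝ W]

/-- A smooth map on a finite-dimensional space can be cut off outside any ball. -/
lemma exists_contDiff_hasCompactSupport_eqOn_closedBall [FiniteDimensional ℝ V] {g : V → W}
    (hg : ContDiff ℝ ∞ g) (R : ℝ) :
    ∃ ψ : V → W, ContDiff ℝ ∞ ψ ∧ HasCompactSupport ψ ∧
      EqOn ψ g (Metric.closedBall 0 R) ∧ ∀ z, ‖ψ z‖ ≤ ‖g z‖ := by
  let β : ContDiffBump (0 : V) := ⟨max R 1, max R 1 + 1, by positivity, by linarith⟩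
  refine ⟨fun z => β z • g z, β.contDiff.smul hg, β.hasCompactSupport.smul_right, ?_, ?_⟩
  · intro z hz
    have : β z = 1 := β.one_of_mem_closedBall
      (Metric.closedBall_subset_closedBall (le_max_left _ _) hz)
    simp [this]
  · intro z
    rw [norm_smul, Real.norm_of_nonneg β.nonneg]
    exact mul_le_of_le_one_left (norm_nonneg _) β.le_one

/-- Quadratic remainder estimate, uniform on a ball. -/
lemma exists_norm_sub_sub_fderiv_le_mul_sq [FiniteDimensional ℝ V] {g : V → W}
    (hg : ContDiff ℝ ∞ g) (R : ℝ) :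
    ∃ M : ℝ, 0 ≤ M ∧ ∀ z ∈ Metric.ball (0 : V) R, ∀ z' ∈ Metric.ball (0 : V) R,
      ‖g z' - g z - fderiv ℝ g z (z' - z)‖ ≤ M * ‖z' - z‖ ^ 2 := by
  obtain ⟨ψ, hψ, hc, heq, -⟩ := exists_contDiff_hasCompactSupport_eqOn_closedBall hg R
  obtain ⟨K, hK⟩ := ContDiff.lipschitzWith_of_hasCompactSupport (𝕂 := ℝ) (hc.fderiv ℝ)
    (hψ.fderiv_right (m := 1) (by norm_cast)) one_ne_zero
  refine ⟨K, K.2, fun z hz z' hz' => ?_⟩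
  have hfd : fderiv ℝ ψ z = fderiv ℝ g z := by
    apply Filter.EventuallyEq.fderiv_eq
    filter_upwards [Metric.isOpen_ball.mem_nhds hz] with y hy
    exact heq (Metric.ball_subset_closedBall hy)
  rw [← hfd, ← heq (Metric.ball_subset_closedBall hz), ← heq (Metric.ball_subset_closedBall hz')]
  -- This ball around `z` may leave the ball of radius `R`, so the mean value inequality is applied
  -- to `ψ`, whose derivative is globally Lipschitz.
  have := Convex.norm_image_sub_le_of_norm_hasFDerivWithin_le' (𝕜 := ℝ) (f := ψ)
    (f' := fderiv ℝ ψ) (s := Metric.closedBall z ‖z' - z‖) (φ := fderiv ℝ ψ z)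
    (C := K * ‖z' - z‖) (x := z) (y := z')
    (fun y _ => ((hψ.differentiable (by simp)) y).hasFDerivAt.hasFDerivWithinAt)
    (fun y hy => by
      have h1 := hK.dist_le_mul y z
      rw [dist_eq_norm] at h1
      exact h1.trans (by gcongr; exact hy)) (convex_closedBall _ _)
    (by simp) (by simp [dist_eq_norm])
  rwa [sq, ← mul_assoc]

/-- Solutions of a smooth control system with smooth control are smooth. -/
lemma contDiffOn_of_hasDerivAt_of_contDiff {C : Type*} [NormedAddCommGroup C] [NormedSpace ℝ C]
    {Φ : V × C → V} (hΦ : ContDiff ℝ ∞ Φ) {S : Set ℝ} (hS : IsOpen S) {c : ℝ → C}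
    (hc : ContDiffOn ℝ ∞ c S) {y : ℝ → V} (hy : ∀ s ∈ S, HasDerivAt y (Φ (y s, c s)) s) :
    ContDiffOn ℝ ∞ y S := by
  rw [contDiffOn_infty]
  intro n
  -- Bootstrap: if `y` is `C^n`, so is the right-hand side of its equation.
  induction n with
  | zero =>
    exact contDiffOn_zero.2 fun s hs => (hy s hs).continuousAt.continuousWithinAt
  | succ n ih =>
    rw [Nat.cast_succ, contDiffOn_succ_iff_deriv_of_isOpen hS]
    refine ⟨fun s hs => (hy s hs).differentiableAt.differentiableWithinAt, by simp, ?_⟩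
    have : ContDiffOn ℝ n (fun s => Φ (y s, c s)) S :=
      (hΦ.of_le (by exact_mod_cast le_top)).comp_contDiffOn
        (ih.prodMk (hc.of_le (by exact_mod_cast le_top)))
    exact this.congr fun s hs => (hy s hs).deriv

/-- Global existence for a control system whose right-hand side has compact support. -/
lemma exists_hasDerivWithinAt_of_hasCompactSupport [CompleteSpace V]
    {C : Type*} [NormedAddCommGroup C] [NormedSpace ℝ C]
    {Ψ : V × C → V} (hΨ : ContDiff ℝ 1 Ψ) (hs : HasCompactSupport Ψ) {a b : ℝ} (hab : a ≤ b)
    {c : ℝ → C} (hc : ContinuousOn c (Icc a b)) (y₀ : V) :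
    ∃ y : ℝ → V, y a = y₀ ∧ ∀ s ∈ Icc a b, HasDerivWithinAt y (Ψ (y s, c s)) (Icc a b) s := by
  obtain ⟨K, hK⟩ := hΨ.lipschitzWith_of_hasCompactSupport hs one_ne_zero
  obtain ⟨B, hB⟩ := hs.exists_bound_of_continuous hΨ.continuous
  have hB0 : 0 ≤ B := (norm_nonneg _).trans (hB (y₀, c a))
  -- A field bounded by `B` moves a point by at most `B * (b - a)`; with this radius one application
  -- covers all of `[a, b]`.
  have hP : IsPicardLindelof (fun s y => Ψ (y, c s)) (tmin := a) (tmax := b)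
      ⟨a, left_mem_Icc.2 hab⟩ y₀ (⟨B, hB0⟩ * ⟨b - a, sub_nonneg.2 hab⟩) 0 ⟨B, hB0⟩ K :=
    { lipschitzOnWith := fun s _ => (lipschitzWith_left_of_prod hK (c s)).lipschitzOnWith
      continuousOn := fun y _ => hΨ.continuous.comp_continuousOn (continuousOn_const.prodMk hc)
      norm_le := fun s _ y _ => hB _
      mul_max_le := by
        have : (0 : ℝ) ≤ b - a := sub_nonneg.2 hab
        simp only [sub_self, max_eq_left this, NNReal.coe_zero, sub_zero]
        rfl }
  exact hP.exists_eq_forall_mem_Icc_hasDerivWithinAt₀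

/-- A continuous curve on `[a, b]` whose derivative on `]a, b[` extends continuously to `[a, b]`
is right differentiable on `[a, b[`. -/
lemma hasDerivWithinAt_Ici_of_hasDerivAt_Ioo {a b : ℝ} {y w : ℝ → V}
    (hy : ContinuousOn y (Icc a b)) (hw : ContinuousOn w (Icc a b))
    (hd : ∀ s ∈ Ioo a b, HasDerivAt y (w s) s) :
    ∀ s ∈ Ico a b, HasDerivWithinAt y (w s) (Ici s) s := by
  rintro s ⟨has, hsb⟩
  rcases has.eq_or_lt with rfl | has
  · apply hasDerivWithinAt_Ici_of_tendsto_deriv (s := Ioo a b)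
    · exact fun s hs => (hd s hs).differentiableAt.differentiableWithinAt
    · exact (hy a ⟨le_rfl, hsb.le⟩).mono Ioo_subset_Icc_self
    · exact Ioo_mem_nhdsGT hsb
    · have h1 : Tendsto w (𝓝[>] a) (𝓝 (w a)) := by
        rw [← nhdsWithin_Ioo_eq_nhdsGT hsb]
        exact (hw a ⟨le_rfl, hsb.le⟩).mono Ioo_subset_Icc_self
      refine h1.congr' ?_
      filter_upwards [Ioo_mem_nhdsGT hsb] with s hs
      exact (hd s hs).deriv.symm
  · exact (hd s ⟨has, hsb⟩).hasDerivWithinAt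

lemma hasDerivWithinAt_Ici_of_Icc {a b : ℝ} {y w : ℝ → V}
    (hd : ∀ s ∈ Icc a b, HasDerivWithinAt y (w s) (Icc a b) s) :
    ∀ s ∈ Ico a b, HasDerivWithinAt y (w s) (Ici s) s := fun s hs =>
  (hd s (Ico_subset_Icc_self hs)).mono_of_mem_nhdsWithin
    (mem_of_superset (Icc_mem_nhdsGE hs.2) (Icc_subset_Icc_left hs.1))

/-- `gronwallBound` with zero initial value is linear in the perturbation. -/
lemma gronwallBound_zero_mul (K c e s : ℝ) :
    gronwallBound 0 K (c * e) s = c * gronwallBound 0 K e s := by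
  by_cases hK : K = 0
  · simp [hK, gronwallBound_K0, mul_assoc]
  · simp only [gronwallBound_of_K_ne_0 hK]; ring

/-- Two solutions with the same initial value and `e`-close controls are `O(e)`-close. -/
lemma dist_le_of_dist_control_le {C : Type*} [NormedAddCommGroup C]
    {Ψ : V × C → V} {K : NNReal} (hK : LipschitzWith K Ψ) {a b e : ℝ}
    {c c' : ℝ → C} (hcc : ∀ s ∈ Icc a b, dist (c' s) (c s) ≤ e) {x y : ℝ → V}
    (hx : ContinuousOn x (Icc a b)) (hy : ContinuousOn y (Icc a b))
    (hx' : ∀ s ∈ Ico a b, HasDerivWithinAt x (Ψ (x s, c s)) (Ici s) s)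
    (hy' : ∀ s ∈ Ico a b, HasDerivWithinAt y (Ψ (y s, c' s)) (Ici s) s)
    (ha : y a = x a) :
    ∀ s ∈ Icc a b, dist (y s) (x s) ≤ e * gronwallBound 0 K K (b - a) := by
  intro s hs
  have he : 0 ≤ e := dist_nonneg.trans (hcc s hs)
  -- `y` is an approximate solution of the equation of `x`, with error at most `e * K`.
  have h := dist_le_of_approx_trajectories_ODE (v := fun s z => Ψ (z, c s)) (K := K)
    (εf := e * K) (εg := 0) (δ := 0)
    (fun s => lipschitzWith_left_of_prod hK (c s))
    hy hy' (fun s hs => by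
      refine (hK.dist_le_mul _ _).trans ?_
      rw [mul_comm]
      have := hcc s (Ico_subset_Icc_self hs)
      gcongr
      rw [Prod.dist_eq, dist_self]
      exact max_le he this) hx hx' (fun s _ => by simp) (by simp [ha]) s hs
  rw [add_zero, gronwallBound_zero_mul] at h
  refine h.trans (mul_le_mul_of_nonneg_left ?_ he)
  exact gronwallBound_mono le_rfl K.2 K.2 (by linarith [hs.2])

/-- Global existence for a control system of at most linear growth in the state. -/
lemma exists_hasDerivWithinAt_of_linear_growth [FiniteDimensional ℝ V]
    {C : Type*} [NormedAddCommGroup C] [NormedSpace ℝ C] [FiniteDimensional ℝ C]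
    {Φ : V × C → V} (hΦ : ContDiff ℝ ∞ Φ) {a b : ℝ} (hab : a ≤ b)
    {c : ℝ → C} (hc : ContinuousOn c (Icc a b)) {A B : ℝ} (hA : 0 ≤ A) (hB : 0 ≤ B)
    (hAB : ∀ s ∈ Icc a b, ∀ q, ‖Φ (q, c s)‖ ≤ A * ‖q‖ + B) (y₀ : V) :
    ∃ y : ℝ → V, y a = y₀ ∧ ∀ s ∈ Icc a b, HasDerivWithinAt y (Φ (y s, c s)) (Icc a b) s := by
  obtain ⟨D, hD⟩ := isCompact_Icc.exists_bound_of_continuousOn hc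
  obtain ⟨Ψ, hΨ, hs, heq, hle⟩ := exists_contDiff_hasCompactSupport_eqOn_closedBall hΦ
    (max D (gronwallBound ‖y₀‖ A B (b - a)))
  have := FiniteDimensional.complete ℝ V
  obtain ⟨y, hya, hy⟩ := exists_hasDerivWithinAt_of_hasCompactSupport
    (hΨ.of_le (by norm_cast)) hs hab hc y₀
  refine ⟨y, hya, fun s hs => ?_⟩
  -- The cut-off does not increase norms, so the growth bound survives and `y` never leaves the
  -- region where `Ψ = Φ`.
  have hbd : ‖y s‖ ≤ gronwallBound ‖y₀‖ A B (b - a) := by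
    refine (norm_le_gronwallBound_of_norm_deriv_right_le (δ := ‖y₀‖) (K := A) (ε := B)
      (fun s hs => (hy s hs).continuousWithinAt) (hasDerivWithinAt_Ici_of_Icc hy)
      (by rw [hya]) (fun s hs => (hle _).trans (hAB s (Ico_subset_Icc_self hs) _)) s hs).trans ?_
    exact gronwallBound_mono (norm_nonneg _) hB hA (by linarith [hs.2])
  rw [← heq]
  · exact hy s hs
  · rw [mem_closedBall_zero_iff, Prod.norm_def]
    exact max_le (hbd.trans (le_max_right _ _)) ((hD s hs).trans (le_max_left _ _))

/-- Global backward existence for a control system of at most linear growth in the state. -/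
lemma exists_hasDerivWithinAt_of_linear_growth_backward [FiniteDimensional ℝ V]
    {C : Type*} [NormedAddCommGroup C] [NormedSpace ℝ C] [FiniteDimensional ℝ C]
    {Φ : V × C → V} (hΦ : ContDiff ℝ ∞ Φ) {a b : ℝ} (hab : a ≤ b)
    {c : ℝ → C} (hc : ContinuousOn c (Icc a b)) {A B : ℝ} (hA : 0 ≤ A) (hB : 0 ≤ B)
    (hAB : ∀ s ∈ Icc a b, ∀ q, ‖Φ (q, c s)‖ ≤ A * ‖q‖ + B) (y₀ : V) :
    ∃ y : ℝ → V, y b = y₀ ∧ ∀ s ∈ Icc a b, HasDerivWithinAt y (Φ (y s, c s)) (Icc a b) s := by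
  have hm : MapsTo (fun s : ℝ => a + b - s) (Icc a b) (Icc a b) := fun s hs =>
    ⟨by linarith [hs.2], by linarith [hs.1]⟩
  obtain ⟨y, hya, hy⟩ := exists_hasDerivWithinAt_of_linear_growth (Φ := fun z => -Φ z) hΦ.neg hab
    (c := fun s => c (a + b - s)) (hc.comp (by fun_prop) hm) hA hB
    (fun s hs q => by simpa using hAB _ (hm hs) q) y₀
  refine ⟨fun s => y (a + b - s), by simpa using hya, fun s hs => ?_⟩
  have h := (hy _ (hm hs)).scomp s
    (((hasDerivAt_id s).const_sub (a + b)).hasDerivWithinAt (s := Icc a b)) hm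
  simpa [Function.comp_def] using h

end Analysis

variable {E : Type*} [NormedAddCommGroup E] [NormedSpace ℝ E]

/-! ### Partial derivatives of the Hamiltonian -/

section Hamiltonian

/-- The Hamiltonian as a function of one variable in the product space. -/
def uncurriedHamiltonian {U : Submodule ℝ E} (f : E × U → E) (L : E × U → ℝ)
    (z : E × StrongDual ℝ E × U) : ℝ :=
  hamiltonian f L z.1 z.2.1 z.2.2

variable {U : Submodule ℝ E} {f : E × U → E} {L : E × U → ℝ}

lemma contDiff_uncurriedHamiltonian (hf : ContDiff ℝ ∞ f) (hL : ContDiff ℝ ∞ L) :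
    ContDiff ℝ ∞ (uncurriedHamiltonian f L) := by
  have h : ContDiff ℝ ∞ fun z : E × StrongDual ℝ E × U => (z.1, z.2.2) := by fun_prop
  exact (contDiff_snd.fst.clm_apply (hf.comp h)).sub (hL.comp h)

lemma partialX_apply (hf : ContDiff ℝ ∞ f) (hL : ContDiff ℝ ∞ L) (x : E) (p : StrongDual ℝ E)
    (u : U) (d : E) : partialX (hamiltonian f L) x p u d =
      fderiv ℝ (uncurriedHamiltonian f L) (x, p, u) (d, 0, 0) := by
  have h1 := ((contDiff_uncurriedHamiltonian hf hL).differentiable (by simp) (x, p, u)).hasFDerivAt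
  have h2 : HasFDerivAt (fun y : E => (y, p, u))
      (ContinuousLinearMap.inl ℝ E (StrongDual ℝ E × U)) x := hasFDerivAt_prodMk_left _ _
  exact DFunLike.congr_fun (HasFDerivAt.comp x h1 h2).fderiv d

lemma partialU_apply (hf : ContDiff ℝ ∞ f) (hL : ContDiff ℝ ∞ L) (x : E) (p : StrongDual ℝ E)
    (u w : U) : partialU (hamiltonian f L) x p u w =
      fderiv ℝ (uncurriedHamiltonian f L) (x, p, u) (0, 0, w) := by
  have h1 := ((contDiff_uncurriedHamiltonian hf hL).differentiable (by simp) (x, p, u)).hasFDerivAt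
  have h2 : HasFDerivAt (fun v : U => (x, p, v))
      ((ContinuousLinearMap.inr ℝ E (StrongDual ℝ E × U)).comp
        (ContinuousLinearMap.inr ℝ (StrongDual ℝ E) U)) u :=
    (hasFDerivAt_prodMk_right x (p, u)).comp u (hasFDerivAt_prodMk_right p u)
  exact DFunLike.congr_fun (HasFDerivAt.comp u h1 h2).fderiv w

lemma partialP_eq [FiniteDimensional ℝ E] (x : E) (p : StrongDual ℝ E) (u : U) :
    partialP (hamiltonian f L) x p u = f (x, u) := by
  have h : HasFDerivAt (fun q : StrongDual ℝ E => hamiltonian f L x q u)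
      (ContinuousLinearMap.apply ℝ ℝ (f (x, u))) p :=
    (ContinuousLinearMap.apply ℝ ℝ (f (x, u))).hasFDerivAt.sub_const (L (x, u))
  rw [partialP, h.fderiv, LinearEquiv.symm_apply_eq]
  ext φ
  simp

/-- The coefficients of the costate equation. -/
lemma partialX_eq (hf : ContDiff ℝ ∞ f) (hL : ContDiff ℝ ∞ L) (x : E) (p : StrongDual ℝ E)
    (u : U) : partialX (hamiltonian f L) x p u =
      p.comp ((fderiv ℝ f (x, u)).comp (ContinuousLinearMap.inl ℝ E U)) -
        (fderiv ℝ L (x, u)).comp (ContinuousLinearMap.inl ℝ E U) := by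
  have h2 : HasFDerivAt (fun y : E => (y, u)) (ContinuousLinearMap.inl ℝ E U) x :=
    hasFDerivAt_prodMk_left _ _
  have h3 := (hf.differentiable (by simp) (x, u)).hasFDerivAt.comp x h2
  have h4 := (hL.differentiable (by simp) (x, u)).hasFDerivAt.comp x h2
  exact ((p.hasFDerivAt.comp x h3).sub h4).fderiv

end Hamiltonian

/-! ### Costate and control variations on one interval -/

section Interval

variable {U : Submodule ℝ E} {f : E × U → E} {L : E × U → ℝ} {a b : ℝ}

/-- Endpoint values of the control are irrelevant to the dynamics and to one-sided limits. This lets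
the control be replaced by its continuous extension to `[a, b]`. -/
lemma IsAdmissible.congr_control {xa : E} {x : ℝ → E} {u v : ℝ → U} (hab : a < b)
    (h : IsAdmissible f a b xa x u) (huv : EqOn u v (Ioo a b)) : IsAdmissible f a b xa x v where
  continuousOn_state := h.continuousOn_state
  smooth_state := h.smooth_state
  smooth_control :=
    { smooth := h.smooth_control.smooth.congr fun s hs => (huv hs).symm
      limit_left_end := h.smooth_control.limit_left_end.imp fun _ hl =>
        hl.congr' (mem_of_superset (Ioo_mem_nhdsGT hab) huv)
      limit_right_end := h.smooth_control.limit_right_end.imp fun _ hl =>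
        hl.congr' (mem_of_superset (Ioo_mem_nhdsLT hab) huv) }
  initial := h.initial
  dynamics s hs := by rw [← huv hs]; exact h.dynamics s hs

lemma bolzaCost_congr_control {G : E → ℝ} {ε : ℝ} {x : ℝ → E} {u v : ℝ → U} (hab : a ≤ b)
    (huv : EqOn u v (Ioo a b)) : bolzaCost L G ε a b x u = bolzaCost L G ε a b x v := by
  unfold bolzaCost
  congr 1
  rw [intervalIntegral.integral_of_le hab, intervalIntegral.integral_of_le hab,
    integral_Ioc_eq_integral_Ioo, integral_Ioc_eq_integral_Ioo]
  exact setIntegral_congr_fun measurableSet_Ioo fun s hs => by simp only [huv hs]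

lemma SmoothWithLimits.of_contDiffOn_continuousOn {F : Type*} [NormedAddCommGroup F]
    [NormedSpace ℝ F] (hab : a < b) {y : ℝ → F} (hy : ContDiffOn ℝ ∞ y (Ioo a b))
    (hc : ContinuousOn y (Icc a b)) : SmoothWithLimits a b y where
  smooth := hy
  limit_left_end := ⟨y a, by
    rw [← nhdsWithin_Ioo_eq_nhdsGT hab]
    exact (hc a ⟨le_rfl, hab.le⟩).mono Ioo_subset_Icc_self⟩
  limit_right_end := ⟨y b, by
    rw [← nhdsWithin_Ioo_eq_nhdsLT hab]
    exact (hc b ⟨hab.le, le_rfl⟩).mono Ioo_subset_Icc_self⟩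

lemma SmoothWithLimits.exists_continuousOn_extension {F : Type*} [NormedAddCommGroup F]
    [NormedSpace ℝ F] {y : ℝ → F} (h : SmoothWithLimits a b y) :
    ∃ z : ℝ → F, ContinuousOn z (Icc a b) ∧ EqOn y z (Ioo a b) := by
  obtain ⟨l, hl⟩ := h.limit_left_end
  obtain ⟨r, hr⟩ := h.limit_right_end
  refine ⟨extendFrom (Ioo a b) y, continuousOn_Icc_extendFrom_Ioo h.smooth.continuousOn hl hr,
    fun s hs => (extendFrom_eq (subset_closure hs) ?_).symm⟩
  exact (h.smooth.continuousOn s hs)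

variable [FiniteDimensional ℝ E]

/-- The backward Cauchy problem for the costate equation. -/
lemma exists_costate (hf : ContDiff ℝ ∞ f) (hL : ContDiff ℝ ∞ L) (hab : a ≤ b)
    {x : ℝ → E} {u : ℝ → U} (hx : ContinuousOn x (Icc a b)) (hu : ContinuousOn u (Icc a b))
    (hxs : ContDiffOn ℝ ∞ x (Ioo a b)) (hus : ContDiffOn ℝ ∞ u (Ioo a b)) (pb : StrongDual ℝ E) :
    ∃ p : ℝ → StrongDual ℝ E, ContinuousOn p (Icc a b) ∧ ContDiffOn ℝ ∞ p (Ioo a b) ∧ p b = pb ∧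
      ∀ s ∈ Ioo a b,
        HasDerivAt p (-partialX (hamiltonian f L) (x s) (p s) (u s)) s := by
  let A : E × U → E →L[ℝ] E := fun c => (fderiv ℝ f c).comp (ContinuousLinearMap.inl ℝ E U)
  let B : E × U → StrongDual ℝ E := fun c => (fderiv ℝ L c).comp (ContinuousLinearMap.inl ℝ E U)
  have hA : ContDiff ℝ ∞ A :=
    (hf.fderiv_right (m := ∞) (by simp)).clm_comp contDiff_const
  have hB : ContDiff ℝ ∞ B :=
    (hL.fderiv_right (m := ∞) (by simp)).clm_comp contDiff_const
  let Φ : StrongDual ℝ E × E × U → StrongDual ℝ E := fun z => -(z.1.comp (A z.2) - B z.2)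
  have hΦ : ContDiff ℝ ∞ Φ :=
    ((contDiff_fst.clm_comp (hA.comp contDiff_snd)).sub (hB.comp contDiff_snd)).neg
  have hc : ContinuousOn (fun s => (x s, u s)) (Icc a b) := hx.prodMk hu
  obtain ⟨MA, hMA⟩ := isCompact_Icc.exists_bound_of_continuousOn
    (hA.continuous.comp_continuousOn hc)
  obtain ⟨MB, hMB⟩ := isCompact_Icc.exists_bound_of_continuousOn
    (hB.continuous.comp_continuousOn hc)
  have ha : a ∈ Icc a b := ⟨le_rfl, hab⟩
  obtain ⟨p, hpb, hp⟩ := exists_hasDerivWithinAt_of_linear_growth_backward hΦ hab hc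
    ((norm_nonneg _).trans (hMA a ha)) ((norm_nonneg _).trans (hMB a ha))
    (fun s hs q => by
      simp only [Φ, norm_neg]
      refine (norm_sub_le _ _).trans (add_le_add ?_ (hMB s hs))
      refine (ContinuousLinearMap.opNorm_comp_le _ _).trans ?_
      rw [mul_comm]
      exact mul_le_mul_of_nonneg_right (hMA s hs) (norm_nonneg _)) pb
  have hp' : ∀ s ∈ Ioo a b, HasDerivAt p (Φ (p s, x s, u s)) s := fun s hs =>
    (hp s (Ioo_subset_Icc_self hs)).hasDerivAt (Icc_mem_nhds hs.1 hs.2)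
  refine ⟨p, fun s hs => (hp s hs).continuousWithinAt,
    contDiffOn_of_hasDerivAt_of_contDiff hΦ isOpen_Ioo (hxs.prodMk hus) hp', hpb, fun s hs => ?_⟩
  rw [partialX_eq hf hL]
  exact hp' s hs

/-- Small smooth variations of the control lead to admissible trajectories on the whole interval,
which depend in a Lipschitz way on the variation parameter. -/
lemma exists_admissible_variation (hf : ContDiff ℝ ∞ f) (hab : a < b)
    {x : ℝ → E} {u : ℝ → U} (hu : ContinuousOn u (Icc a b))
    (h : IsAdmissible f a b (x a) x u) {w : ℝ → U} (hw : ContDiff ℝ ∞ w) :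
    ∃ C : ℝ, 0 ≤ C ∧ ∃ η > 0, ∀ l : ℝ, |l| ≤ η → ∃ y : ℝ → E,
      IsAdmissible f a b (x a) y (fun s => u s + l • w s) ∧
      ∀ s ∈ Icc a b, ‖y s - x s‖ ≤ C * |l| := by
  have hx := h.continuousOn_state
  have hwc : ContinuousOn w (Icc a b) := hw.continuous.continuousOn
  obtain ⟨R, hR⟩ := isCompact_Icc.exists_bound_of_continuousOn (hx.prodMk hu)
  obtain ⟨D, hD⟩ := isCompact_Icc.exists_bound_of_continuousOn hwc
  have hD0 : 0 ≤ D := (norm_nonneg _).trans (hD a ⟨le_rfl, hab.le⟩)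
  obtain ⟨Ψ, hΨ, hs, heq, -⟩ := exists_contDiff_hasCompactSupport_eqOn_closedBall hf (R + 1)
  obtain ⟨K, hK⟩ := hΨ.lipschitzWith_of_hasCompactSupport hs (by simp)
  have hg0 : 0 ≤ gronwallBound 0 K K (b - a) := by
    have := gronwallBound_mono (δ := 0) le_rfl K.2 K.2 (sub_nonneg.2 hab.le)
    rwa [gronwallBound_x0] at this
  set g := gronwallBound 0 K K (b - a)
  -- This `η` keeps the displacements of both state and control at most `1`, the margin left by the
  -- cut-off radius `R + 1`.
  refine ⟨D * g, by positivity, 1 / (D * g + D + 1), by positivity, fun l hl => ?_⟩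
  have hl' : |l| * (D * g + D + 1) ≤ 1 := by
    rwa [← le_div_iff₀ (by positivity)]
  have hv : ContinuousOn (fun s => u s + l • w s) (Icc a b) := hu.add (hwc.const_smul l)
  have := FiniteDimensional.complete ℝ E
  obtain ⟨y, hya, hy⟩ := exists_hasDerivWithinAt_of_hasCompactSupport
    (hΨ.of_le (by norm_cast)) hs hab.le hv (x a)
  have hyc : ContinuousOn y (Icc a b) := fun s hs => (hy s hs).continuousWithinAt
  have hxd : ∀ s ∈ Ico a b, HasDerivWithinAt x (Ψ (x s, u s)) (Ici s) s := by
    refine hasDerivWithinAt_Ici_of_hasDerivAt_Ioo hx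
      (hΨ.continuous.comp_continuousOn (hx.prodMk hu)) fun s hs => ?_
    rw [heq]
    · exact h.dynamics s hs
    · rw [mem_closedBall_zero_iff]
      linarith [hR s (Ioo_subset_Icc_self hs)]
  have hdist : ∀ s ∈ Icc a b, ‖y s - x s‖ ≤ D * g * |l| := fun s hs => by
    have := dist_le_of_dist_control_le hK (c := u) (c' := fun s => u s + l • w s) (e := |l| * D)
      (fun s hs => by
        rw [dist_eq_norm, add_sub_cancel_left, norm_smul, Real.norm_eq_abs]
        exact mul_le_mul_of_nonneg_left (hD s hs) (abs_nonneg _)) hx hyc hxd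
      (hasDerivWithinAt_Ici_of_Icc hy) hya s hs
    rw [dist_eq_norm] at this
    linarith
  have hyd : ∀ s ∈ Ioo a b, HasDerivAt y (f (y s, u s + l • w s)) s := fun s hs => by
    have hs' := Ioo_subset_Icc_self hs
    rw [← heq]
    · exact (hy s hs').hasDerivAt (Icc_mem_nhds hs.1 hs.2)
    · have h1 : (y s, u s + l • w s) = (x s, u s) + (y s - x s, l • w s) := by simp
      rw [mem_closedBall_zero_iff, h1]
      refine (norm_add_le _ _).trans (add_le_add (hR s hs') ?_)
      rw [Prod.norm_def]
      have hl0 := abs_nonneg l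
      refine max_le ((hdist s hs').trans (le_trans ?_ hl')) ?_
      · nlinarith
      · dsimp only
        rw [norm_smul, Real.norm_eq_abs]
        refine le_trans (mul_le_mul_of_nonneg_left ((hD s hs').trans ?_) hl0) hl'
        have : 0 ≤ D * g := by positivity
        linarith
  have hvs : ContDiffOn ℝ ∞ (fun s => u s + l • w s) (Ioo a b) :=
    h.smooth_control.smooth.add (hw.const_smul l).contDiffOn
  exact ⟨y,
    { continuousOn_state := hyc
      smooth_state := .of_contDiffOn_continuousOn hab
        (contDiffOn_of_hasDerivAt_of_contDiff hf isOpen_Ioo hvs hyd) hyc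
      smooth_control := .of_contDiffOn_continuousOn hab hvs hv
      initial := hya
      dynamics := hyd }, hdist⟩

end Interval

/-! ### First variation of the cost and stationarity -/

section Stationarity

variable {U : Submodule ℝ E} {f : E × U → E} {L : E × U → ℝ} {a b : ℝ}

/-- Exact expression of a cost increment by means of the costate. -/
lemma bolzaCost_sub_eq (hf : ContDiff ℝ ∞ f) (hL : ContDiff ℝ ∞ L) (hab : a < b)
    {G : E → ℝ} {ε : ℝ} {x : ℝ → E} {u : ℝ → U} (hu : ContinuousOn u (Icc a b))
    (h : IsAdmissible f a b (x a) x u) {p : ℝ → StrongDual ℝ E} (hpc : ContinuousOn p (Icc a b))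
    (hp : ∀ s ∈ Ioo a b, HasDerivAt p (-partialX (hamiltonian f L) (x s) (p s) (u s)) s)
    (hpb : p b = -((1 / ε) • fderiv ℝ G (x b))) {y : ℝ → E} {v : ℝ → U}
    (hv : ContinuousOn v (Icc a b)) (hy : IsAdmissible f a b (x a) y v) :
    bolzaCost L G ε a b y v - bolzaCost L G ε a b x u
      + ∫ s in a..b, partialU (hamiltonian f L) (x s) (p s) (u s) (v s - u s) =
    1 / ε * (G (y b) - G (x b) - fderiv ℝ G (x b) (y b - x b)) -
      ∫ s in a..b, (uncurriedHamiltonian f L (y s, p s, v s)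
        - uncurriedHamiltonian f L (x s, p s, u s)
        - fderiv ℝ (uncurriedHamiltonian f L) (x s, p s, u s)
          ((y s, p s, v s) - (x s, p s, u s))) := by
  have hH := contDiff_uncurriedHamiltonian hf hL
  have hx := h.continuousOn_state
  have hyc := hy.continuousOn_state
  have hDH : ContinuousOn (fun s => fderiv ℝ (uncurriedHamiltonian f L) (x s, p s, u s))
      (Icc a b) := (hH.continuous_fderiv (by simp)).comp_continuousOn (hx.prodMk (hpc.prodMk hu))
  have hint : ∀ {g : ℝ → ℝ}, ContinuousOn g (Icc a b) → IntervalIntegrable g volume a b :=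
    fun hg => hg.intervalIntegrable_of_Icc hab.le
  have cLy : ContinuousOn (fun s => L (y s, v s)) (Icc a b) :=
    hL.continuous.comp_continuousOn (hyc.prodMk hv)
  have cLx : ContinuousOn (fun s => L (x s, u s)) (Icc a b) :=
    hL.continuous.comp_continuousOn (hx.prodMk hu)
  have cfy := hf.continuous.comp_continuousOn (hyc.prodMk hv)
  have cfx := hf.continuous.comp_continuousOn (hx.prodMk hu)
  have cX : ContinuousOn (fun s => partialX (hamiltonian f L) (x s) (p s) (u s) (y s - x s))
      (Icc a b) := by
    simp only [partialX_apply hf hL]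
    exact hDH.clm_apply ((hyc.sub hx).prodMk continuousOn_const)
  have cU : ContinuousOn (fun s => partialU (hamiltonian f L) (x s) (p s) (u s) (v s - u s))
      (Icc a b) := by
    simp only [partialU_apply hf hL]
    exact hDH.clm_apply (continuousOn_const.prodMk (continuousOn_const.prodMk (hv.sub hu)))
  have cD : ContinuousOn (fun s => -partialX (hamiltonian f L) (x s) (p s) (u s) (y s - x s)
      + p s (f (y s, v s) - f (x s, u s))) (Icc a b) :=
    cX.neg.add (hpc.clm_apply (cfy.sub cfx))
  -- The integrand is the derivative of `p (y - x)`; the term at `a` vanishes by the common initial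
  -- state, the one at `b` comes from the terminal condition.
  have hfund : ∫ s in a..b, (-partialX (hamiltonian f L) (x s) (p s) (u s) (y s - x s)
      + p s (f (y s, v s) - f (x s, u s))) = -(1 / ε * fderiv ℝ G (x b) (y b - x b)) := by
    rw [intervalIntegral.integral_eq_sub_of_hasDerivAt_of_le hab.le
      (f := fun s => p s (y s - x s)) (hpc.clm_apply (hyc.sub hx)) _ (hint cD)]
    · simp [hpb, hy.initial]
    · intro s hs
      exact (hp s hs).clm_apply ((hy.dynamics s hs).sub (h.dynamics s hs))
  -- The same `p` appears in both points, so `δh/δp` does not contribute.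
  have hrem : ∀ s, uncurriedHamiltonian f L (y s, p s, v s)
      - uncurriedHamiltonian f L (x s, p s, u s)
      - fderiv ℝ (uncurriedHamiltonian f L) (x s, p s, u s)
        ((y s, p s, v s) - (x s, p s, u s)) =
      (-partialX (hamiltonian f L) (x s) (p s) (u s) (y s - x s)
        + p s (f (y s, v s) - f (x s, u s)))
      - L (y s, v s) + L (x s, u s)
      - partialU (hamiltonian f L) (x s) (p s) (u s) (v s - u s) := fun s => by
    have h1 : (y s, p s, v s) - (x s, p s, u s) =
        (y s - x s, 0, 0) + ((0 : E), (0 : StrongDual ℝ E), v s - u s) := by simp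
    rw [h1, map_add, partialX_apply hf hL, partialU_apply hf hL, map_sub]
    simp only [uncurriedHamiltonian, hamiltonian]
    ring
  simp only [hrem]
  have c1 := cD.fun_sub cLy
  have c2 := c1.fun_add cLx
  rw [intervalIntegral.integral_sub (hint c2) (hint cU),
    intervalIntegral.integral_add (hint c1) (hint cLx),
    intervalIntegral.integral_sub (hint cD) (hint cLy), hfund]
  unfold bolzaCost
  ring

/-- Taking `l = r` and `l = -r` and dividing by `r` gives `|I| ≤ k` for every `k > 0`. -/
lemma eq_zero_of_forall_mul_le {I : ℝ}
    (h : ∀ k > 0, ∃ r > 0, ∀ l : ℝ, |l| ≤ r → l * I ≤ k * |l|) : I = 0 := by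
  rw [← abs_eq_zero]
  refine le_antisymm (le_of_forall_pos_le_add fun k hk => ?_) (abs_nonneg I)
  obtain ⟨r, hr, H⟩ := h k hk
  rw [zero_add]
  have h1 := H r (abs_of_pos hr).le
  have h2 := H (-r) (by rw [abs_neg, abs_of_pos hr])
  rw [abs_neg] at h2
  rw [abs_of_pos hr] at h1 h2
  refine abs_le'.2 ⟨?_, ?_⟩ <;> refine le_of_mul_le_mul_left ?_ hr <;> linarith

variable [FiniteDimensional ℝ E]

/-- The first variation of the cost vanishes at an optimal control. -/
lemma integral_partialU_eq_zero (hf : ContDiff ℝ ∞ f) (hL : ContDiff ℝ ∞ L) (hab : a < b)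
    {G : E → ℝ} (hG : Differentiable ℝ G) {ε : ℝ}
    {x : ℝ → E} {u : ℝ → U} (hu : ContinuousOn u (Icc a b))
    (h : IsBolzaOptimal f L G ε a b (x a) x u) {p : ℝ → StrongDual ℝ E}
    (hpc : ContinuousOn p (Icc a b))
    (hp : ∀ s ∈ Ioo a b, HasDerivAt p (-partialX (hamiltonian f L) (x s) (p s) (u s)) s)
    (hpb : p b = -((1 / ε) • fderiv ℝ G (x b))) {w : ℝ → U} (hw : ContDiff ℝ ∞ w) :
    ∫ s in a..b, partialU (hamiltonian f L) (x s) (p s) (u s) (w s) = 0 := by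
  have hx := h.1.continuousOn_state
  have hwc : ContinuousOn w (Icc a b) := hw.continuous.continuousOn
  obtain ⟨C, hC, η, hη, hvar⟩ := exists_admissible_variation hf hab hu h.1 hw
  obtain ⟨R, hR⟩ := isCompact_Icc.exists_bound_of_continuousOn (hx.prodMk (hpc.prodMk hu))
  obtain ⟨D, hD⟩ := isCompact_Icc.exists_bound_of_continuousOn hwc
  have ha : a ∈ Icc a b := ⟨le_rfl, hab.le⟩
  have hb : b ∈ Icc a b := ⟨hab.le, le_rfl⟩
  have hD0 : 0 ≤ D := (norm_nonneg _).trans (hD a ha)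
  obtain ⟨M, hM, htaylor⟩ := exists_norm_sub_sub_fderiv_le_mul_sq
    (contDiff_uncurriedHamiltonian hf hL) (R + (C + D) * η + 1)
  refine eq_zero_of_forall_mul_le fun k hk => ?_
  -- The tolerance `k` is split evenly: `τ` gives half to the remainder of `G`, only `o(l)` since
  -- `G` is merely differentiable; the other half absorbs the quadratic remainder `m * |l| ^ 2`.
  set τ := k / 2 / (|1 / ε| * C + 1) with hτ
  have hτ0 : 0 < τ := by positivity
  obtain ⟨ρ, hρ, hGρ⟩ := Metric.eventually_nhds_iff.1
    ((hasFDerivAt_iff_isLittleO.1 (hG (x b)).hasFDerivAt).def hτ0)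
  set m := M * (C + D) ^ 2 * (b - a) with hm
  have hm0 : 0 ≤ m := by have := sub_pos.2 hab; positivity
  refine ⟨min η (min (ρ / (C + 1) / 2) (k / 2 / (m + 1))), by positivity, fun l hl => ?_⟩
  obtain ⟨hl1, hl2, hl3⟩ : |l| ≤ η ∧ |l| ≤ ρ / (C + 1) / 2 ∧ |l| ≤ k / 2 / (m + 1) := by
    simpa using hl
  have hl0 := abs_nonneg l
  obtain ⟨y, hy, hyx⟩ := hvar l hl1
  have hid := bolzaCost_sub_eq hf hL hab hu h.1 hpc hp hpb (hu.fun_add (hwc.fun_const_smul l)) hy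
  have hopt := h.2 y _ hy
  have hG' : |G (y b) - G (x b) - fderiv ℝ G (x b) (y b - x b)| ≤ τ * (C * |l|) := by
    have hlt : dist (y b) (x b) < ρ := by
      rw [dist_eq_norm]
      refine (hyx b hb).trans_lt ?_
      have h1 : |l| * (C + 1) ≤ ρ / 2 := by
        rw [← le_div_iff₀ (by positivity)]; rwa [div_right_comm] at hl2
      nlinarith
    exact (hGρ hlt).trans (mul_le_mul_of_nonneg_left (hyx b hb) hτ0.le)
  have hI : |∫ s in a..b, (uncurriedHamiltonian f L (y s, p s, u s + l • w s)
        - uncurriedHamiltonian f L (x s, p s, u s)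
        - fderiv ℝ (uncurriedHamiltonian f L) (x s, p s, u s)
          ((y s, p s, u s + l • w s) - (x s, p s, u s)))| ≤ m * |l| ^ 2 := by
    have := intervalIntegral.norm_integral_le_of_norm_le_const (a := a) (b := b)
      (C := M * ((C + D) * |l|) ^ 2) (f := fun s =>
        uncurriedHamiltonian f L (y s, p s, u s + l • w s)
        - uncurriedHamiltonian f L (x s, p s, u s)
        - fderiv ℝ (uncurriedHamiltonian f L) (x s, p s, u s)
          ((y s, p s, u s + l • w s) - (x s, p s, u s))) (fun s hs => by
        rw [uIoc_of_le hab.le] at hs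
        have hs' := Ioc_subset_Icc_self hs
        have hd : ‖(y s, p s, u s + l • w s) - (x s, p s, u s)‖ ≤ (C + D) * |l| := by
          have e1 : (y s, p s, u s + l • w s) - (x s, p s, u s) = (y s - x s, 0, l • w s) := by
            simp
          rw [e1, Prod.norm_def, Prod.norm_def, norm_zero, norm_smul, Real.norm_eq_abs]
          have e2 := hyx s hs'
          have e3 := mul_le_mul_of_nonneg_left (hD s hs') hl0
          have e4 : 0 ≤ C * |l| := by positivity
          have e5 : 0 ≤ D * |l| := by positivity
          refine max_le ?_ (max_le ?_ ?_) <;> linarith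
        have hCη : (C + D) * |l| ≤ (C + D) * η := by gcongr
        have hRs := hR s hs'
        refine (htaylor _ ?_ _ ?_).trans ?_
        · rw [mem_ball_zero_iff]
          have : 0 ≤ (C + D) * η := by positivity
          linarith
        · rw [mem_ball_zero_iff]
          have := norm_le_norm_add_norm_sub' (y s, p s, u s + l • w s) (x s, p s, u s)
          linarith
        · gcongr)
    rw [Real.norm_eq_abs, abs_of_pos (sub_pos.2 hab)] at this
    refine this.trans (le_of_eq ?_)
    rw [hm]; ring
  have hU : ∫ s in a..b, partialU (hamiltonian f L) (x s) (p s) (u s) (u s + l • w s - u s) =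
      l * ∫ s in a..b, partialU (hamiltonian f L) (x s) (p s) (u s) (w s) := by
    rw [← intervalIntegral.integral_const_mul]
    simp
  rw [hU] at hid
  have h1 : 1 / ε * (G (y b) - G (x b) - fderiv ℝ G (x b) (y b - x b)) ≤ k / 2 * |l| := by
    refine (le_abs_self _).trans ?_
    rw [abs_mul]
    calc |1 / ε| * _ ≤ |1 / ε| * (τ * (C * |l|)) := by gcongr
      _ = (|1 / ε| * C) * τ * |l| := by ring
      _ ≤ (|1 / ε| * C + 1) * τ * |l| := by gcongr; linarith
      _ = k / 2 * |l| := by rw [hτ]; field_simp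
  have h2 : m * |l| ^ 2 ≤ k / 2 * |l| := by
    have : |l| * (m + 1) ≤ k / 2 := by rwa [← le_div_iff₀ (by positivity)]
    nlinarith
  have h3 := (abs_le.1 hI).1
  linarith

/-- The necessary conditions for a Bolza problem on one interval. -/
theorem IsBolzaOptimal.exists_costate (hf : ContDiff ℝ ∞ f) (hL : ContDiff ℝ ∞ L) (hab : a < b)
    {G : E → ℝ} (hG : Differentiable ℝ G) {ε : ℝ} {x : ℝ → E} {u : ℝ → U}
    (h : IsBolzaOptimal f L G ε a b (x a) x u) :
    ∃ p : ℝ → StrongDual ℝ E, SmoothWithLimits a b p ∧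
      (∀ s ∈ Ioo a b, HasDerivAt p (-partialX (hamiltonian f L) (x s) (p s) (u s)) s ∧
        partialU (hamiltonian f L) (x s) (p s) (u s) = 0) ∧
      Tendsto p (𝓝[<] b) (𝓝 (-((1 / ε) • fderiv ℝ G (x b)))) := by
  obtain ⟨v, hv, huv⟩ := h.1.smooth_control.exists_continuousOn_extension
  have hopt : IsBolzaOptimal f L G ε a b (x a) x v :=
    ⟨h.1.congr_control hab huv, fun y w hy => by
      rw [← bolzaCost_congr_control hab.le huv]; exact h.2 y w hy⟩
  have hx := h.1.continuousOn_state
  obtain ⟨p, hpc, hps, hpb, hp⟩ := BolzaChain.exists_costate hf hL hab.le hx hv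
    h.1.smooth_state.smooth hopt.1.smooth_control.smooth (-((1 / ε) • fderiv ℝ G (x b)))
  have hcont : ∀ e : U, ContinuousOn
      (fun s => partialU (hamiltonian f L) (x s) (p s) (v s) e) (Icc a b) := fun e => by
    simp only [partialU_apply hf hL]
    exact (((contDiff_uncurriedHamiltonian hf hL).continuous_fderiv (by simp)).comp_continuousOn
      (hx.prodMk (hpc.prodMk hv))).clm_apply continuousOn_const
  have hzero : ∀ e : U, EqOn (fun s => partialU (hamiltonian f L) (x s) (p s) (v s) e)
      (fun _ => 0) (Ioo a b) := fun e => by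
    -- Fundamental lemma, with variations `φ • e` for bump functions `φ` supported in the open
    -- interval.
    have hae := isOpen_Ioo.ae_eq_zero_of_integral_contDiff_smul_eq_zero (μ := volume)
      (((hcont e).mono Ioo_subset_Icc_self).locallyIntegrableOn measurableSet_Ioo)
      (fun φ hφ _ hsupp => by
        have h0 := integral_partialU_eq_zero hf hL hab hG hv hopt hpc hp hpb
          (w := fun s => φ s • e) (hφ.smul contDiff_const)
        rw [intervalIntegral.integral_of_le hab.le, integral_Ioc_eq_integral_Ioo,
          setIntegral_eq_integral_of_forall_compl_eq_zero] at h0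
        · simpa using h0
        · intro s hs
          have : φ s = 0 := image_eq_zero_of_notMem_tsupport fun hs' => hs (hsupp hs')
          simp [this])
    refine Measure.eqOn_open_of_ae_eq (μ := volume) ?_ isOpen_Ioo
      ((hcont e).mono Ioo_subset_Icc_self) continuousOn_const
    exact (ae_restrict_iff' measurableSet_Ioo).2 hae
  refine ⟨p, .of_contDiffOn_continuousOn hab hps hpc, fun s hs => ?_, ?_⟩
  · rw [huv hs]
    exact ⟨hp s hs, ContinuousLinearMap.ext fun e => hzero e hs⟩
  · rw [← hpb, ← nhdsWithin_Ioo_eq_nhdsLT hab]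
    exact (hpc b ⟨hab.le, le_rfl⟩).mono Ioo_subset_Icc_self

/-- Curves given on each interval of a partition can be glued together. -/
lemma exists_eqOn_Ioo_of_strictMono {F : Type*} [AddCommMonoid F] {N : ℕ}
    {t : Fin (N + 1) → ℝ} (ht : StrictMono t) (q : Fin N → ℝ → F) :
    ∃ p : ℝ → F, ∀ j : Fin N, EqOn p (q j) (Ioo (t j.castSucc) (t j.succ)) := by
  classical
  -- The open intervals are disjoint, so at most one summand is nonzero.
  refine ⟨fun s => ∑ j, (Ioo (t j.castSucc) (t j.succ)).indicator (q j) s, fun j s hs => ?_⟩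
  dsimp only
  rw [Finset.sum_eq_single j, indicator_of_mem hs]
  · intro i _ hij
    refine indicator_of_notMem (fun hi => ?_) _
    rcases lt_or_gt_of_ne hij with hlt | hlt
    · have := ht.monotone (show i.succ ≤ j.castSucc from hlt)
      linarith [hs.1, hi.2]
    · have := ht.monotone (show j.succ ≤ i.castSucc from hlt)
      linarith [hs.2, hi.1]
  · simp

end Stationarity

end BolzaChain

theorem theorem1 {E : Type*} [NormedAddCommGroup E] [NormedSpace ℝ E] [FiniteDimensional ℝ E]
    (U : Submodule ℝ E)
    (f : E × U → E) (hf : ContDiff ℝ ∞ f)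
    (L : E × U → ℝ) (hL : ContDiff ℝ ∞ L)
    (N : ℕ) (G : Fin N → E → ℝ) (hG : ∀ j, Differentiable ℝ (G j))
    (ε : ℝ) (hε : 0 < ε)
    (T : ℝ) (hT : 0 < T)
    (t : Fin (N + 1) → ℝ) (ht : StrictMono t) (ht0 : t 0 = 0) (htN : t (Fin.last N) = T)
    (x₀ : E) (x : ℝ → E) (u : ℝ → U)
    (hopt : BolzaChain.IsChainOptimal f L G ε t x₀ x u) :
    ∃ p : ℝ → StrongDual ℝ E,
      BolzaChain.PiecewiseSmooth t p ∧
      ∀ j : Fin N,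
        (∀ s ∈ Ioo (t j.castSucc) (t j.succ),
          HasDerivAt x
            (BolzaChain.partialP (BolzaChain.hamiltonian f L) (x s) (p s) (u s)) s ∧
          HasDerivAt p
            (-BolzaChain.partialX (BolzaChain.hamiltonian f L) (x s) (p s) (u s)) s ∧
          BolzaChain.partialU (BolzaChain.hamiltonian f L) (x s) (p s) (u s) = 0) ∧
        Tendsto p (𝓝[<] (t j.succ))
          (𝓝 (-((1 / ε) • fderiv ℝ (G j) (x (t j.succ))))) := by
  have hlt : ∀ j : Fin N, t j.castSucc < t j.succ := fun j => ht (Fin.castSucc_lt_succ)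
  choose q hq hODE hlim using fun j =>
    (hopt.optimal j).exists_costate hf hL (hlt j) (hG j)
  obtain ⟨p, hp⟩ := BolzaChain.exists_eqOn_Ioo_of_strictMono ht q
  refine ⟨p, fun j => ⟨(hq j).smooth.congr (hp j), (hq j).limit_left_end.imp fun _ h =>
      h.congr' (mem_of_superset (Ioo_mem_nhdsGT (hlt j)) fun s hs => (hp j hs).symm),
    (hq j).limit_right_end.imp fun _ h =>
      h.congr' (mem_of_superset (Ioo_mem_nhdsLT (hlt j)) fun s hs => (hp j hs).symm)⟩,
    fun j => ⟨fun s hs => ?_, (hlim j).congr'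
      (mem_of_superset (Ioo_mem_nhdsLT (hlt j)) fun s hs => (hp j hs).symm)⟩⟩
  rw [BolzaChain.partialP_eq, hp j hs]
  refine ⟨(hopt.optimal j).1.dynamics s hs, ?_, (hODE j s hs).2⟩
  -- The derivative transfers because `p` and `q j` agree near `s`, not only at `s`.
  refine (hODE j s hs).1.congr_of_eventuallyEq ?_
  filter_upwards [isOpen_Ioo.mem_nhds hs] with r hr using hp j hr
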